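/- Consider $n\ge 1$ spins with local Hilbert space $\mathbb{C}^q$, $q\ge 1$. For $\Lambda\subseteq[n]=\{1,\dots,n\}$ let $\mathcal{O}_\Lambda$ be the set of self-adjoint linear operators on $\bigotimes_{x\in\Lambda}\mathbb{C}^q$, regarded also as operators on $(\mathbb{C}^q)^{\otimes n}$ by tensoring with the identity on the spins outside $\Lambda$, and let $\|\cdot\|$ be the operator norm. The local norm of an observable $H\in\mathcal{O}_{[n]}$ is $$\|H\|_{\mathrm{loc}} = 2\min\Big\{\max_{x\in[n]}\sum_{\Lambda\ni x}\|h_\Lambda\| \;:\; H=\sum_{\Lambda\subseteq[n]}h_\Lambda,\ h_\Lambda\in\mathcal{O}_\Lambda\Big\}.$$ Let $\omega=\bigotimes_{x\in[n]}\omega_x$ be a product state, where each $\omega_x$ is a quantum state (positive semidefinite operator of trace one) on $\mathbb{C}^q$, and write $\langle X\rangle=\mathrm{Tr}[\omega X]$. Let $H\in\mathcal{O}_{[n]}$. Then the minimum defining $\|H\|_{\mathrm{loc}}$ is attained, and for every decomposition $H=\sum_{\Lambda\subseteq[n]}\tilde h_\Lambda$, $\tilde h_\Lambda\in\mathcal{O}_\Lambda$,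 that achieves it, setting $h_\Lambda=\tilde h_\Lambda-\langle\tilde h_\Lambda\rangle$, one has $$\langle e^H\rangle \le \exp\Big[\langle H\rangle+\sum_{\Lambda\subseteq[n]}\Big(e^{|\Lambda|\,\|H\|_{\mathrm{loc}}}-1-\frac{|\Lambda|\,\|H\|_{\mathrm{loc}}}{2}\Big)\|h_\Lambda\|\Big].$$ -/

import Mathlib

open scoped Matrix.Norms.L2Operator ComplexOrder

noncomputable section

namespace SpinSystem

/-- Labels of the product basis of `⨂_{x ∈ Λ} ℂ^q`: one basis label of `ℂ^q` for every spin
of the region `Λ`. -/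
abbrev RegionBasis {n : ℕ} (q : ℕ) (Λ : Finset (Fin n)) : Type := Λ → Fin q

/-- Linear operators on `ℋ_Λ = ⨂_{x ∈ Λ} ℂ^q`, written as matrices in the (orthonormal) product
basis. The norm `‖·‖` in force on matrices is the operator norm of the Euclidean (Hilbert space)
norm. -/
abbrev RegionOp {n : ℕ} (q : ℕ) (Λ : Finset (Fin n)) : Type :=
  Matrix (RegionBasis q Λ) (RegionBasis q Λ) ℂ

/-- Linear operators on the whole Hilbert space `(ℂ^q)^{⊗ n}`, written as matrices in the
product basis. -/
abbrev Op (n q : ℕ) : Type := Matrix (Fin n → Fin q) (Fin n → Fin q) ℂ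

/-- The operator `X ⊗ 1_{Λᶜ}` on `(ℂ^q)^{⊗ n}`, for an operator `X` acting on `ℋ_Λ`. -/
def embed {n q : ℕ} (Λ : Finset (Fin n)) (X : RegionOp q Λ) : Op n q :=
  Matrix.of fun i j =>
    if ∀ x, x ∉ Λ → i x = j x then X (fun x => i x) (fun x => j x) else 0

/-- Density matrices: positive semidefinite with unit trace. -/
def IsState {ι : Type} [Fintype ι] (ρ : Matrix ι ι ℂ) : Prop :=
  ρ.PosSemidef ∧ ρ.trace = 1

/-- The tensor product `⨂_x ρ_x` of one-spin operators. -/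
def tensorOp {n q : ℕ} (ρ : Fin n → Matrix (Fin q) (Fin q) ℂ) : Op n q :=
  Matrix.of fun i j => ∏ x, ρ x (i x) (j x)

/-- Product states of `n` spins: `ω = ⨂_x ρ_x` with every `ρ_x` a state of one spin. -/
def IsProductState {n q : ℕ} (ω : Op n q) : Prop :=
  ∃ ρ : Fin n → Matrix (Fin q) (Fin q) ℂ, (∀ x, IsState (ρ x)) ∧ ω = tensorOp ρ

theorem IsProductState.isHermitian {n q : ℕ} {ω : Op n q} (hω : IsProductState ω) :
    ω.IsHermitian := by
  obtain ⟨ρ, hρ, rfl⟩ := hω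
  ext i j
  simp only [Matrix.conjTranspose_apply, tensorOp, Matrix.of_apply, star_prod]
  exact Finset.prod_congr rfl fun x _ => (hρ x).1.isHermitian.apply (i x) (j x)

/-- The expectation `⟨X⟩ = Tr[ω X]` of an observable `X` in the state `ω`. For self-adjoint `ω`
and `X` the trace is real (`trace_mul_im`), so that the real part loses nothing. -/
def expect {n q : ℕ} (ω X : Op n q) : ℝ := ((ω * X).trace).re

theorem trace_mul_im {n q : ℕ} {ω X : Op n q} (hω : ω.IsHermitian) (hX : X.IsHermitian) :
    ((ω * X).trace).im = 0 := by
  have h : star (ω * X).trace = (ω * X).trace := by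
    rw [← Matrix.trace_conjTranspose, Matrix.conjTranspose_mul, hω.eq, hX.eq, Matrix.trace_mul_comm]
  exact Complex.conj_eq_iff_im.mp h

/-- `H = ∑_{Λ ⊆ [n]} h_Λ` with every `h_Λ` a self-adjoint operator on `ℋ_Λ`. -/
def IsDecomposition {n q : ℕ} (H : Op n q) (h : (Λ : Finset (Fin n)) → RegionOp q Λ) : Prop :=
  (∀ Λ, (h Λ).IsHermitian) ∧ H = ∑ Λ, embed Λ (h Λ)

/-- The local norm `2 max_x ∑_{Λ ∋ x} ‖h_Λ‖` of a decomposition (`0` if there are no spins). -/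
def decompositionNorm {n q : ℕ} (h : (Λ : Finset (Fin n)) → RegionOp q Λ) : ℝ :=
  2 * ⨆ x : Fin n, ∑ Λ : Finset (Fin n) with x ∈ Λ, ‖h Λ‖

/-- The local norm `‖H‖_loc`: the minimal local norm of the decompositions of `H`. -/
def locNorm {n q : ℕ} (H : Op n q) : ℝ :=
  sInf {r : ℝ | ∃ h : (Λ : Finset (Fin n)) → RegionOp q Λ,
    IsDecomposition H h ∧ decompositionNorm h = r}

/-- The decomposition `h` of `H` achieves the local norm of `H`. -/
def IsOptimalDecomposition {n q : ℕ} (H : Op n q)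
    (h : (Λ : Finset (Fin n)) → RegionOp q Λ) : Prop :=
  IsDecomposition H h ∧ decompositionNorm h = locNorm H

/-- The centered operator `X - ⟨X⟩ 1` on `ℋ_Λ`, the expectation being taken in `ω`. -/
def centered {n q : ℕ} (ω : Op n q) (Λ : Finset (Fin n)) (X : RegionOp q Λ) : RegionOp q Λ :=
  X - ((expect ω (embed Λ X) : ℝ) : ℂ) • (1 : RegionOp q Λ)

end SpinSystem

end

/-! Centering splits `H` into the scalar `⟨H⟩`, which contributes `e^⟨H⟩`, and a sum `K` of local
terms of mean zero. The exponential series for `K` produces expectations of words of local terms. In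
a product state a word vanishes as soon as one of its regions is disjoint from all the others
(`IsProductState.trace_mul_prod_eq_zero`); any other word is at most the product of the norms. Hence
`⟨e^K⟩ ≤ ∑ N_m / m!`, where `N_m` is the total weight of the length-`m` words whose overlap graph
has no isolated vertex.

Such graphs can be peeled star by star (`exists_star_removal`): a given vertex lies in a star whose
removal again leaves no isolated vertex. This gives the recursion `clusterWeight_succ_le`, that is
`F' ≤ S' F` for exponential generating functions, so `F 1 ≤ exp (S 1)` by Grönwall
(`sum_div_factorial_le_exp`). Here `S` counts stars. A star with centre `Λ` and `k - 1` leaves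
weighs at most `‖k_Λ‖ x ^ (k - 1)` with `x = |Λ| J`, where `J` bounds the norms of the terms through
any one spin. Summing over `k` gives the function `e^x - 1 - x / 2` of the theorem. -/

namespace SpinSystem
open Finset

/-! ### Removing stars from graphs -/

/-- In a finite graph without isolated vertices, every vertex lies in a star whose removal
leaves no isolated vertices. -/
theorem exists_star_removal {α : Type*} [Fintype α] (R : α → α → Prop)
    (hR : ∀ i j, R i j → R j i) (h : ∀ i, ∃ j, j ≠ i ∧ R i j) (v : α) :
    ∃ A : Finset α, v ∈ A ∧ 2 ≤ A.card ∧ (∃ c ∈ A, ∀ i ∈ A, i ≠ c → R c i) ∧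
      ∀ i, i ∉ A → ∃ j, j ∉ A ∧ j ≠ i ∧ R i j := by
  classical
  -- If `v` has a pendant neighbour, take `v` as centre and all vertices whose only neighbour is `v`
  -- as leaves. A vertex left over has a neighbour `j ≠ v`, and `j` survives because it has that
  -- vertex as a neighbour.
  by_cases hL : ∃ u, u ≠ v ∧ ∀ j, j ≠ u → R u j → j = v
  · obtain ⟨u, huv, hu⟩ := hL
    refine ⟨univ.filter fun w => w = v ∨ ∀ j, j ≠ w → R w j → j = v, by simp, ?_,
      ⟨v, by simp, ?_⟩, ?_⟩
    · rw [← card_pair huv]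
      refine card_le_card fun w hw => ?_
      simp only [mem_insert, mem_singleton] at hw
      rcases hw with rfl | rfl
      · simpa using Or.inr hu
      · simp
    · intro i hi hiv
      obtain ⟨j, hji, hj⟩ := h i
      have hi' : i = v ∨ ∀ j, j ≠ i → R i j → j = v := by simpa using hi
      exact hR _ _ (hi'.resolve_left hiv j hji hj ▸ hj)
    · intro i hi
      simp only [mem_filter, mem_univ, true_and, not_or, not_forall] at hi
      obtain ⟨hiv, j, hji, hj, hjv⟩ := hi
      refine ⟨j, ?_, hji, hj⟩
      simp only [mem_filter, mem_univ, true_and, not_or, not_forall]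
      exact ⟨hjv, i, hji.symm, hR _ _ hj, hiv⟩
  -- Otherwise take a neighbour `u` of `v` as centre and also remove every vertex that has
  -- neighbours only in `{v, u}`. Each of these has a neighbour other than `v`, hence is adjacent to
  -- `u`.
  · push Not at hL
    obtain ⟨u, huv, hvu⟩ := h v
    refine ⟨univ.filter fun w => w = v ∨ w = u ∨ ∀ j, j ≠ w → R w j → j = v ∨ j = u, by simp, ?_,
      ⟨u, by simp, ?_⟩, ?_⟩
    · rw [← card_pair huv]
      refine card_le_card fun w hw => ?_
      simp only [mem_insert, mem_singleton] at hw
      rcases hw with rfl | rfl <;> simp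
    · intro i hi hiu
      by_cases hiv : i = v
      · exact hiv ▸ hR _ _ hvu
      have hi' : i = v ∨ i = u ∨ ∀ j, j ≠ i → R i j → j = v ∨ j = u := by simpa using hi
      obtain ⟨j, hji, hj, hjv⟩ := hL i hiv
      exact hR _ _ ((((hi'.resolve_left hiv).resolve_left hiu) j hji hj).resolve_left hjv ▸ hj)
    · intro i hi
      simp only [mem_filter, mem_univ, true_and, not_or, not_forall] at hi
      obtain ⟨hiv, hiu, j, hji, hj, hjv, hju⟩ := hi
      refine ⟨j, ?_, hji, hj⟩
      simp only [mem_filter, mem_univ, true_and, not_or, not_forall]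
      exact ⟨hjv, hju, i, hji.symm, hR _ _ hj, hiv, hiu⟩

/-! ### Weights of stars and clusters -/

section Clusters

variable {ι : Type*} [Fintype ι] (r : ι → ι → Prop) (a : ι → ℝ)

/-- Every entry of the family is related to some other entry. -/
def NoIsolated {α : Type*} (f : α → ι) : Prop := ∀ i, ∃ j, j ≠ i ∧ r (f i) (f j)

/-- The family has at least two entries, one of which is related to all the others. -/
def IsStar {α : Type*} (f : α → ι) : Prop :=
  Nontrivial α ∧ ∃ c, ∀ i, i ≠ c → r (f c) (f i)

open Classical in
/-- Total weight of the families of labels with a given property. -/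
noncomputable def familyWeight {α : Type*} [Fintype α] [DecidableEq α] (P : (α → ι) → Prop) : ℝ :=
  ∑ f : α → ι, if P f then ∏ i, a (f i) else 0

/-- Total weight of the families of length `m` without isolated entries. -/
noncomputable def clusterWeight (m : ℕ) : ℝ := familyWeight a (NoIsolated r (α := Fin m))

/-- Upper bound for the total weight of the stars with `k` entries. -/
noncomputable def starWeight (x : ι → ℝ) (k : ℕ) : ℝ :=
  if k < 2 then 0 else if k = 2 then ∑ l, a l * x l else k * ∑ l, a l * x l ^ (k - 1)

variable {r a}

theorem familyWeight_nonneg (ha : ∀ l, 0 ≤ a l) {α : Type*} [Fintype α] [DecidableEq α] (P : (α → ι) → Prop) :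
    0 ≤ familyWeight a P := by
  refine sum_nonneg fun f _ => ?_
  split_ifs
  exacts [prod_nonneg fun _ _ => ha _, le_rfl]

theorem familyWeight_noIsolated_eq {α : Type*} [Fintype α] [DecidableEq α] :
    familyWeight a (NoIsolated r (α := α)) = clusterWeight r a (Fintype.card α) := by
  classical
  let e := Fintype.equivFin α
  unfold clusterWeight familyWeight
  refine Fintype.sum_equiv (e.arrowCongr (Equiv.refl ι)) _ _ fun f => ?_
  have h1 : NoIsolated r ((e.arrowCongr (Equiv.refl ι)) f) ↔ NoIsolated r f := by
    constructor
    · intro h i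
      obtain ⟨j, hj, hr⟩ := h (e i)
      refine ⟨e.symm j, fun h => hj (by rw [← h]; simp), by simpa using hr⟩
    · intro h i
      obtain ⟨j, hj, hr⟩ := h (e.symm i)
      refine ⟨e j, fun h => hj (by rw [← h]; simp), by simpa using hr⟩
  have h2 : ∏ i, a ((e.arrowCongr (Equiv.refl ι)) f i) = ∏ i, a (f i) :=
    (Fintype.prod_equiv e _ _ fun i => by simp).symm
  rw [h2]
  simp only [h1]

/-- Once the label of the centre is fixed, the other entries are chosen independently, so the sum
factorizes. -/
theorem familyWeight_center_le (ha : ∀ l, 0 ≤ a l) {x : ι → ℝ}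
    (hx : ∀ (l : ι) [DecidablePred (r l)], ∑ l' with r l l', a l' ≤ x l)
    {α : Type*} [Fintype α] [DecidableEq α] (c : α) :
    familyWeight a (fun f : α → ι => ∀ i, i ≠ c → r (f c) (f i)) ≤
      ∑ l, a l * x l ^ (Fintype.card α - 1) := by
  classical
  have key : familyWeight a (fun f : α → ι => ∀ i, i ≠ c → r (f c) (f i)) =
      ∑ p : ι × ({j // j ≠ c} → ι), a p.1 * ∏ i, if r p.1 (p.2 i) then a (p.2 i) else 0 := by
    refine Fintype.sum_equiv (Equiv.funSplitAt c ι) _ _ fun f => ?_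
    simp only [Equiv.funSplitAt_apply]
    rw [prod_ite_zero]
    simp only [mem_univ, true_implies, Subtype.forall]
    split_ifs with h
    · rw [← Fintype.prod_subtype_mul_prod_subtype (fun j => j = c) (fun i => a (f i))]
      congr 1
      convert Fintype.prod_subsingleton (fun i : {j // j = c} => a (f i)) ⟨c, rfl⟩
    · simp
  rw [key, Fintype.sum_prod_type]
  refine sum_le_sum fun l _ => ?_
  dsimp only
  rw [← mul_sum]
  refine mul_le_mul_of_nonneg_left ?_ (ha l)
  have := (prod_univ_sum (fun _ : {j // j ≠ c} => (univ : Finset ι))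
    (fun _ l' => if r l l' then a l' else 0)).symm
  rw [Fintype.piFinset_univ] at this
  rw [this, prod_const, ← sum_filter]
  have hc : (univ : Finset {j // j ≠ c}).card = Fintype.card α - 1 := by
    rw [card_univ, Fintype.card_subtype_compl, Fintype.card_subtype_eq]
  rw [hc]
  exact pow_le_pow_left₀ (sum_nonneg fun _ _ => ha _) (hx l) _

/-- Union bound over the possible centres, hence the factor `k` in `starWeight`. In a pair either
entry can be the centre, by symmetry of `r`, so one centre suffices; this saving turns `e^x - 1`
into `e^x - 1 - x / 2`. -/
theorem familyWeight_isStar_le (hr : ∀ i j, r i j → r j i) (ha : ∀ l, 0 ≤ a l) {x : ι → ℝ}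
    (hx : ∀ (l : ι) [DecidablePred (r l)], ∑ l' with r l l', a l' ≤ x l)
    {α : Type*} [Fintype α] [DecidableEq α] :
    familyWeight a (IsStar r (α := α)) ≤ starWeight a x (Fintype.card α) := by
  classical
  have hle : ∀ (s : Finset α), (∀ f : α → ι, IsStar r f → ∃ c ∈ s, ∀ i, i ≠ c → r (f c) (f i)) →
      familyWeight a (IsStar r (α := α)) ≤
        s.card * ∑ l, a l * x l ^ (Fintype.card α - 1) := by
    intro s hs
    rw [← nsmul_eq_mul, ← sum_const]
    refine le_trans ?_ (sum_le_sum fun c _ => familyWeight_center_le ha hx c)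
    unfold familyWeight
    rw [sum_comm]
    refine sum_le_sum fun f _ => ?_
    have hp : 0 ≤ ∏ i, a (f i) := prod_nonneg fun _ _ => ha _
    split_ifs with h
    · obtain ⟨c, hc, hcf⟩ := hs f h
      refine le_trans (le_of_eq ?_) (single_le_sum (fun c _ => ?_) hc)
      · rw [if_pos hcf]
      · split_ifs <;> simp [hp]
    · refine sum_nonneg fun c _ => ?_
      split_ifs <;> simp [hp]
  unfold starWeight
  split_ifs with h1 h2
  · refine le_of_eq (sum_eq_zero fun f _ => if_neg fun h => ?_)
    have := Fintype.one_lt_card_iff_nontrivial.2 h.1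
    omega
  · obtain ⟨u, v, huv, huniv⟩ := card_eq_two.1 (card_univ.trans h2)
    have hall : ∀ i, i = u ∨ i = v := fun i => by
      have := mem_univ i
      rw [huniv] at this
      simpa using this
    refine (hle {u} fun f hf => ⟨u, by simp, ?_⟩).trans (by simp [h2])
    obtain ⟨-, c, hc⟩ := hf
    intro i hi
    have hiv : i = v := (hall i).resolve_left hi
    rcases hall c with rfl | rfl
    · exact hc i (hiv ▸ huv.symm)
    · exact hr _ _ (hiv ▸ hc u huv)
  · refine (hle univ fun f hf => ?_).trans (by rw [card_univ])
    obtain ⟨-, c, hc⟩ := hf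
    exact ⟨c, mem_univ _, hc⟩

/-- Union bound over the star `A` supplied by `exists_star_removal`. Relations between `A` and its
complement are forgotten, so the weight factorizes. -/
theorem familyWeight_noIsolated_le (hr : ∀ i j, r i j → r j i) (ha : ∀ l, 0 ≤ a l)
    {α : Type*} [Fintype α] [DecidableEq α] (v : α) :
    familyWeight a (NoIsolated r (α := α)) ≤
      ∑ A : Finset α with v ∈ A, familyWeight a (IsStar r (α := {i // i ∈ A})) *
        familyWeight a (NoIsolated r (α := {i // i ∉ A})) := by
  classical
  have key : ∀ A : Finset α, familyWeight a (IsStar r (α := {i // i ∈ A})) *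
      familyWeight a (NoIsolated r (α := {i // i ∉ A})) =
      familyWeight a (fun f : α → ι => IsStar r (fun i : {i // i ∈ A} => f i) ∧
        NoIsolated r (fun i : {i // i ∉ A} => f i)) := by
    intro A
    unfold familyWeight
    rw [sum_mul_sum, ← Fintype.sum_prod_type']
    symm
    refine Fintype.sum_equiv (Equiv.piEquivPiSubtypeProd (fun i => i ∈ A) (fun _ => ι)) _ _
      fun f => ?_
    simp only [Equiv.piEquivPiSubtypeProd_apply]
    rw [← Fintype.prod_subtype_mul_prod_subtype (fun i => i ∈ A) (fun i => a (f i))]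
    by_cases h1 : IsStar r (fun i : {i // i ∈ A} => f i)
    · by_cases h2 : NoIsolated r (fun i : {i // i ∉ A} => f i)
      · rw [if_pos ⟨h1, h2⟩, if_pos h1, if_pos h2]
        congr!
      · simp [h2]
    · simp [h1]
  simp only [key]
  unfold familyWeight
  rw [sum_comm]
  refine sum_le_sum fun f _ => ?_
  have hp : 0 ≤ ∏ i, a (f i) := prod_nonneg fun _ _ => ha _
  split_ifs with h
  · obtain ⟨A, hvA, hA, ⟨c, hcA, hc⟩, hrest⟩ := exists_star_removal
      (fun i j => r (f i) (f j)) (fun i j => hr _ _) h v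
    refine le_trans (le_of_eq ?_) (single_le_sum (fun A _ => ?_)
      (mem_filter.2 ⟨mem_univ A, hvA⟩))
    · rw [if_pos]
      refine ⟨⟨?_, ⟨c, hcA⟩, fun i hi => hc i i.2 fun h => hi (Subtype.ext h)⟩, ?_⟩
      · rw [← Fintype.one_lt_card_iff_nontrivial, Fintype.card_coe]
        omega
      · intro i
        obtain ⟨j, hj, hji, hij⟩ := hrest i i.2
        exact ⟨⟨j, hj⟩, fun h => hji (congrArg Subtype.val h), hij⟩
    · split_ifs <;> simp [hp]
  · refine sum_nonneg fun c _ => ?_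
    split_ifs <;> simp [hp]

theorem sum_filter_mem_card {α : Type*} [Fintype α] [DecidableEq α] (v : α) (F : ℕ → ℝ) :
    ∑ A : Finset α with v ∈ A, F A.card =
      ∑ j ∈ range (Fintype.card α), ((Fintype.card α - 1).choose j : ℝ) * F (j + 1) := by
  have hc : ((univ : Finset α).erase v).card = Fintype.card α - 1 := by
    rw [card_erase_of_mem (mem_univ v), card_univ]
  have hpos : 0 < Fintype.card α := Fintype.card_pos_iff.2 ⟨v⟩
  have := sum_powerset_apply_card (fun k => F (k + 1)) (x := (univ : Finset α).erase v)
  rw [hc, Nat.sub_add_cancel hpos] at this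
  simp only [nsmul_eq_mul] at this
  rw [← this]
  refine sum_bij' (fun A _ => A.erase v) (fun B _ => insert v B) ?_ ?_ ?_ ?_ ?_
  · intro A _
    exact mem_powerset.2 (erase_subset_erase v (subset_univ A))
  · intro B _
    simp
  · intro A hA
    exact insert_erase (mem_filter.1 hA).2
  · intro B hB
    exact erase_insert fun h => by simpa using mem_powerset.1 hB h
  · intro A hA
    rw [card_erase_add_one (mem_filter.1 hA).2]

theorem starWeight_nonneg (ha : ∀ l, 0 ≤ a l) {x : ι → ℝ} (hx0 : ∀ l, 0 ≤ x l) (k : ℕ) :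
    0 ≤ starWeight a x k := by
  unfold starWeight
  split_ifs
  · exact le_rfl
  · exact sum_nonneg fun l _ => mul_nonneg (ha l) (hx0 l)
  · exact mul_nonneg (Nat.cast_nonneg _)
      (sum_nonneg fun l _ => mul_nonneg (ha l) (pow_nonneg (hx0 l) _))

/-- The peeled star is the one through entry `0`; its `j` further entries are chosen among the
remaining `m`. -/
theorem clusterWeight_succ_le (hr : ∀ i j, r i j → r j i) (ha : ∀ l, 0 ≤ a l) {x : ι → ℝ}
    (hx : ∀ (l : ι) [DecidablePred (r l)], ∑ l' with r l l', a l' ≤ x l) (m : ℕ) :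
    clusterWeight r a (m + 1) ≤ ∑ j ∈ range (m + 1),
      (m.choose j : ℝ) * (starWeight a x (j + 1) * clusterWeight r a (m - j)) := by
  classical
  refine (familyWeight_noIsolated_le hr ha (0 : Fin (m + 1))).trans ?_
  have := sum_filter_mem_card (0 : Fin (m + 1))
    (fun k => starWeight a x k * clusterWeight r a (m + 1 - k))
  simp only [Fintype.card_fin, Nat.add_sub_cancel, Nat.add_sub_add_right] at this
  rw [← this]
  refine sum_le_sum fun A _ => ?_
  have h1 := familyWeight_isStar_le hr ha hx (α := {i // i ∈ A})
  have h2 := familyWeight_noIsolated_eq (r := r) (a := a) (α := {i // i ∉ A})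
  rw [Fintype.card_coe] at h1
  rw [Fintype.card_subtype_compl, Fintype.card_coe, Fintype.card_fin] at h2
  rw [h2]
  exact mul_le_mul_of_nonneg_right h1 (familyWeight_nonneg ha _)

theorem clusterWeight_zero : clusterWeight r a 0 = 1 := by
  unfold clusterWeight familyWeight
  simp [NoIsolated]

theorem sum_starWeight_div_factorial_le (ha : ∀ l, 0 ≤ a l) {x : ι → ℝ} (hx0 : ∀ l, 0 ≤ x l)
    (M : ℕ) : ∑ j ∈ range M, starWeight a x (j + 1) / (j + 1).factorial ≤
      ∑ l, (Real.exp (x l) - 1 - x l / 2) * a l := by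
  -- The number `k` of possible centres cancels against `k!`, leaving `x ^ (k - 1) / (k - 1)!`.
  have hterm : ∀ j, starWeight a x (j + 3) / (j + 3).factorial =
      ∑ l, a l * (x l ^ (j + 2) / (j + 2).factorial) := by
    intro j
    unfold starWeight
    rw [if_neg (by omega), if_neg (by omega), Nat.factorial_succ (j + 2)]
    have h1 : ((j + 2).factorial : ℝ) ≠ 0 := by positivity
    have h2 : ((j + 2 + 1 : ℕ) : ℝ) ≠ 0 := by positivity
    push_cast at h2 ⊢
    rw [mul_sum, sum_div]
    refine sum_congr rfl fun l _ => ?_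
    have h3 : ((j : ℝ) + 3) ≠ 0 := by positivity
    have h4 : ((j : ℝ) + 2 + 1) ≠ 0 := by positivity
    field_simp
    ring
  -- Two extra terms make room for splitting off `k = 1` and `k = 2`, which do not follow the
  -- general pattern.
  have hle : ∑ j ∈ range M, starWeight a x (j + 1) / (j + 1).factorial ≤
      ∑ j ∈ range (M + 2), starWeight a x (j + 1) / (j + 1).factorial := by
    refine sum_le_sum_of_subset_of_nonneg (range_mono (by omega)) fun j _ _ => ?_
    exact div_nonneg (starWeight_nonneg ha hx0 _) (Nat.cast_nonneg _)
  refine hle.trans ?_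
  rw [sum_range_succ', sum_range_succ']
  simp only [add_assoc, Nat.reduceAdd, zero_add, hterm]
  rw [sum_comm]
  have h1 : starWeight a x 1 = 0 := by simp [starWeight]
  have h2 : starWeight a x 2 = ∑ l, a l * x l := by simp [starWeight]
  rw [h1, h2, zero_div, add_zero, sum_div, ← sum_add_distrib]
  refine sum_le_sum fun l _ => ?_
  rw [← mul_sum]
  have hexp := Real.sum_le_exp_of_nonneg (hx0 l) (M + 2)
  rw [sum_range_succ', sum_range_succ'] at hexp
  simp only [add_assoc, Nat.reduceAdd, zero_add, pow_one, pow_zero, Nat.factorial] at hexp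
  simp only [Nat.factorial]
  push_cast at hexp ⊢
  have := mul_le_mul_of_nonneg_left hexp (ha l)
  linarith

/-! ### Exponential generating functions -/

/-- A linear recursion of convolution type is dominated by the exponential of its kernel. -/
theorem sum_div_factorial_le_exp {N s : ℕ → ℝ} (hN : ∀ m, 0 ≤ N m) (hs : ∀ m, 0 ≤ s m)
    (hN0 : N 0 ≤ 1)
    (hrec : ∀ m, N (m + 1) ≤ ∑ j ∈ range (m + 1), (m.choose j : ℝ) * (s (j + 1) * N (m - j)))
    (M : ℕ) : ∑ m ∈ range (M + 1), N m / m.factorial ≤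
      Real.exp (∑ j ∈ range M, s (j + 1) / (j + 1).factorial) := by
  set F : ℝ → ℝ := fun t => ∑ m ∈ range (M + 1), N m / m.factorial * t ^ m with hF
  set F' : ℝ → ℝ := fun t => ∑ m ∈ range M, N (m + 1) / m.factorial * t ^ m with hF'
  set S : ℝ → ℝ := fun t => ∑ j ∈ range M, s (j + 1) / (j + 1).factorial * t ^ (j + 1) with hS
  set S' : ℝ → ℝ := fun t => ∑ j ∈ range M, s (j + 1) / j.factorial * t ^ j with hS'
  have fac : ∀ m : ℕ, ((m + 1).factorial : ℝ) = (m + 1) * m.factorial := fun m => by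
    rw [Nat.factorial_succ]; push_cast; ring
  have dF : ∀ t, HasDerivAt F (F' t) t := by
    intro t
    have : F = fun t => ∑ m ∈ range M, N (m + 1) / (m + 1).factorial * t ^ (m + 1) + N 0 := by
      funext t
      simp [hF, sum_range_succ']
    rw [this]
    refine HasDerivAt.add_const _ (HasDerivAt.fun_sum fun m _ => ?_)
    refine ((hasDerivAt_pow (m + 1) t).const_mul _).congr_deriv ?_
    rw [fac]
    have : (m.factorial : ℝ) ≠ 0 := by positivity
    have : (m : ℝ) + 1 ≠ 0 := by positivity
    push_cast
    field_simp
  have dS : ∀ t, HasDerivAt S (S' t) t := by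
    intro t
    refine HasDerivAt.fun_sum fun m _ => ?_
    refine ((hasDerivAt_pow (m + 1) t).const_mul _).congr_deriv ?_
    rw [fac]
    have : (m.factorial : ℝ) ≠ 0 := by positivity
    have : (m : ℝ) + 1 ≠ 0 := by positivity
    push_cast
    field_simp
  have hle : ∀ t, 0 ≤ t → F' t ≤ S' t * F t := by
    intro t ht
    set u : ℕ → ℝ := fun j => s (j + 1) / j.factorial * t ^ j with hu
    set w : ℕ → ℝ := fun m => N m / m.factorial * t ^ m with hw
    have hu0 : ∀ j, 0 ≤ u j := fun j =>
      mul_nonneg (div_nonneg (hs _) (Nat.cast_nonneg _)) (pow_nonneg ht _)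
    have hw0 : ∀ j, 0 ≤ w j := fun j =>
      mul_nonneg (div_nonneg (hN _) (Nat.cast_nonneg _)) (pow_nonneg ht _)
    -- As `m.choose j / m! = 1 / (j! (m - j)!)`, the recursion becomes a Cauchy product.
    have h1 : ∀ m, N (m + 1) / m.factorial * t ^ m ≤ ∑ j ∈ range (m + 1), u j * w (m - j) := by
      intro m
      have h := mul_le_mul_of_nonneg_right (hrec m)
        (mul_nonneg (inv_nonneg.2 (Nat.cast_nonneg m.factorial)) (pow_nonneg ht m))
      rw [sum_mul] at h
      refine (le_of_eq (by ring)).trans (h.trans (le_of_eq (sum_congr rfl fun j hj => ?_)))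
      have hjm : j ≤ m := by simpa [Nat.lt_succ_iff] using hj
      rw [Nat.cast_choose ℝ hjm, hu, hw]
      simp only
      rw [show t ^ m = t ^ j * t ^ (m - j) by rw [← pow_add, Nat.add_sub_cancel' hjm]]
      have : (m.factorial : ℝ) ≠ 0 := by positivity
      field_simp
    calc F' t ≤ ∑ m ∈ range M, ∑ j ∈ range (m + 1), u j * w (m - j) :=
          sum_le_sum fun m _ => h1 m
      _ ≤ ∑ m ∈ range M, ∑ j ∈ range M, if j ≤ m then u j * w (m - j) else 0 := by
          refine sum_le_sum fun m hm => ?_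
          rw [← sum_filter]
          refine sum_le_sum_of_subset_of_nonneg (fun j hj => ?_)
            fun _ _ _ => mul_nonneg (hu0 _) (hw0 _)
          simp only [mem_range, mem_filter] at hj hm ⊢
          omega
      _ = ∑ j ∈ range M, u j * ∑ m ∈ range M, if j ≤ m then w (m - j) else 0 := by
          rw [sum_comm]
          simp only [mul_sum, mul_ite, mul_zero]
      -- For each `j`, the shifted inner sum is part of the nonnegative sum defining `F t`.
      _ ≤ ∑ j ∈ range M, u j * ∑ m ∈ range (M + 1), w m := by
          refine sum_le_sum fun j _ => mul_le_mul_of_nonneg_left ?_ (hu0 j)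
          rw [← sum_filter]
          have hinj : Set.InjOn (fun m => m - j) ((range M).filter fun m => j ≤ m) := by
            intro p hp p' hp' hpp
            simp only [coe_filter, mem_range, Set.mem_ofPred_eq] at hp hp' hpp
            omega
          rw [← sum_image (f := w) hinj]
          refine sum_le_sum_of_subset_of_nonneg (fun k hk => ?_) fun _ _ _ => hw0 _
          simp only [mem_image, mem_filter, mem_range] at hk ⊢
          omega
      _ = S' t * F t := by rw [← sum_mul]
  -- Grönwall: `F' ≤ S' F` makes `F exp (-S)` decrease from `N 0 ≤ 1`.
  have hanti : AntitoneOn (fun t => F t * Real.exp (-S t)) (Set.Icc 0 1) := by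
    have hd : ∀ t, HasDerivAt (fun t => F t * Real.exp (-S t))
        (F' t * Real.exp (-S t) + F t * (Real.exp (-S t) * (-S' t))) t := fun t =>
      (dF t).mul ((dS t).neg.exp)
    refine antitoneOn_of_deriv_nonpos (convex_Icc 0 1)
      (fun t _ => (hd t).continuousAt.continuousWithinAt)
      (fun t _ => (hd t).differentiableAt.differentiableWithinAt) fun t ht => ?_
    rw [interior_Icc] at ht
    rw [(hd t).deriv]
    have := mul_nonneg (sub_nonneg.2 (hle t ht.1.le)) (Real.exp_pos (-S t)).le
    nlinarith
  have h01 := hanti (Set.left_mem_Icc.2 zero_le_one) (Set.right_mem_Icc.2 zero_le_one) zero_le_one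
  have hF0 : F 0 = N 0 := by simp [hF, sum_range_succ']
  have hS0 : S 0 = 0 := by simp [hS]
  have hF1 : F 1 = ∑ m ∈ range (M + 1), N m / m.factorial := by simp [hF]
  have hS1 : S 1 = ∑ j ∈ range M, s (j + 1) / (j + 1).factorial := by simp [hS]
  simp only [hF0, hS0, hF1, hS1, neg_zero, Real.exp_zero, mul_one, Real.exp_neg] at h01
  have hpos := Real.exp_pos (∑ j ∈ range M, s (j + 1) / (j + 1).factorial)
  have h2 := h01.trans hN0
  rwa [← div_eq_mul_inv, div_le_one hpos] at h2

theorem sum_clusterWeight_div_factorial_le (hr : ∀ i j, r i j → r j i) (ha : ∀ l, 0 ≤ a l)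
    {x : ι → ℝ} (hx0 : ∀ l, 0 ≤ x l)
    (hx : ∀ (l : ι) [DecidablePred (r l)], ∑ l' with r l l', a l' ≤ x l) (M : ℕ) :
    ∑ m ∈ range M, clusterWeight r a m / m.factorial ≤
      Real.exp (∑ l, (Real.exp (x l) - 1 - x l / 2) * a l) := by
  have hN : ∀ m, 0 ≤ clusterWeight r a m := fun m => familyWeight_nonneg ha _
  calc _ ≤ ∑ m ∈ range (M + 1), clusterWeight r a m / m.factorial :=
        sum_le_sum_of_subset_of_nonneg (range_mono (by omega)) fun m _ _ =>
          div_nonneg (hN m) (Nat.cast_nonneg _)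
    _ ≤ _ := sum_div_factorial_le_exp hN (starWeight_nonneg ha hx0) clusterWeight_zero.le
        (clusterWeight_succ_le hr ha hx) M
    _ ≤ _ := Real.exp_le_exp.2 (sum_starWeight_div_factorial_le ha hx0 M)

end Clusters

end SpinSystem

/-! ### Tensor products and expectations in product states -/

namespace SpinSystem
open Finset
open scoped Kronecker MatrixOrder

section Tensor

variable {κ : Type*} [Fintype κ] {q : ℕ}

/-- Tensor products of one-spin operators over an arbitrary finite set of spins. -/
def tensorMatrix (ρ : κ → Matrix (Fin q) (Fin q) ℂ) :
    Matrix (κ → Fin q) (κ → Fin q) ℂ :=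
  Matrix.of fun i j => ∏ x, ρ x (i x) (j x)

theorem tensorMatrix_mul [DecidableEq κ] (ρ σ : κ → Matrix (Fin q) (Fin q) ℂ) :
    tensorMatrix ρ * tensorMatrix σ = tensorMatrix (fun x => ρ x * σ x) := by
  ext i j
  simp only [tensorMatrix, Matrix.mul_apply, Matrix.of_apply, ← prod_mul_distrib]
  rw [prod_univ_sum, Fintype.piFinset_univ]

theorem tensorMatrix_conjTranspose (ρ : κ → Matrix (Fin q) (Fin q) ℂ) :
    (tensorMatrix ρ).conjTranspose = tensorMatrix (fun x => (ρ x).conjTranspose) := by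
  ext i j
  simp [tensorMatrix, Matrix.conjTranspose_apply]

theorem trace_tensorMatrix [DecidableEq κ] (ρ : κ → Matrix (Fin q) (Fin q) ℂ) :
    (tensorMatrix ρ).trace = ∏ x, (ρ x).trace := by
  simp only [tensorMatrix, Matrix.trace, Matrix.diag, Matrix.of_apply]
  rw [prod_univ_sum, Fintype.piFinset_univ]

theorem posSemidef_tensorMatrix [DecidableEq κ] {ρ : κ → Matrix (Fin q) (Fin q) ℂ}
    (hρ : ∀ x, (ρ x).PosSemidef) : (tensorMatrix ρ).PosSemidef := by
  have h : ∀ x, ∃ B : Matrix (Fin q) (Fin q) ℂ, ρ x = B.conjTranspose * B := fun x => by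
    obtain ⟨B, hB⟩ := CStarAlgebra.nonneg_iff_eq_star_mul_self.1 (hρ x).nonneg
    exact ⟨B, hB⟩
  choose B hB using h
  have : tensorMatrix ρ = (tensorMatrix B).conjTranspose * tensorMatrix B := by
    rw [tensorMatrix_conjTranspose, tensorMatrix_mul]
    exact congrArg _ (funext hB)
  rw [this]
  exact Matrix.posSemidef_conjTranspose_mul_self _

end Tensor

/-- A state is a functional of norm at most one for the operator norm. -/
theorem IsState.norm_trace_mul_le {ι : Type} [Fintype ι] [DecidableEq ι] {ρ : Matrix ι ι ℂ}
    (hρ : IsState ρ) (X : Matrix ι ι ℂ) : ‖(ρ * X).trace‖ ≤ ‖X‖ := by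
  obtain ⟨B, hB⟩ : ∃ B : Matrix ι ι ℂ, ρ = B * B.conjTranspose := by
    obtain ⟨B, hB⟩ := CStarAlgebra.nonneg_iff_eq_mul_star_self.1 hρ.1.nonneg
    exact ⟨B, hB⟩
  -- The columns of `B` satisfy `Tr (ρ X) = ∑ ⟨b k, X b k⟩` and `∑ ‖b k‖ ^ 2 = Tr ρ = 1`;
  -- Cauchy–Schwarz concludes.
  let b : ι → EuclideanSpace ℂ ι := fun k => WithLp.toLp 2 fun i => B i k
  have h1 : (ρ * X).trace =
      ∑ k, inner ℂ (b k) (WithLp.toLp 2 (Matrix.mulVec X (b k))) := by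
    rw [hB, Matrix.mul_assoc, Matrix.trace_mul_comm, Matrix.mul_assoc]
    simp only [Matrix.trace, Matrix.diag, Matrix.mul_apply, Matrix.conjTranspose_apply,
      PiLp.inner_apply, b, Matrix.mulVec, dotProduct, RCLike.inner_apply, RCLike.star_def]
    exact sum_congr rfl fun k _ => sum_congr rfl fun i _ => mul_comm _ _
  have h2 : ρ.trace = ∑ k, ((‖b k‖ ^ 2 : ℝ) : ℂ) := by
    rw [hB, Matrix.trace_mul_comm]
    refine sum_congr rfl fun k _ => ?_
    rw [EuclideanSpace.norm_sq_eq]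
    simp only [Matrix.diag, Matrix.mul_apply, Matrix.conjTranspose_apply, b]
    push_cast
    exact sum_congr rfl fun i _ => RCLike.conj_mul _
  have h3 : ∑ k, ‖b k‖ ^ 2 = 1 := by
    have := h2.symm.trans hρ.2
    exact_mod_cast this
  rw [h1]
  calc _ ≤ ∑ k, ‖inner ℂ (b k) (WithLp.toLp 2 (Matrix.mulVec X (b k)))‖ := norm_sum_le _ _
    _ ≤ ∑ k, ‖X‖ * ‖b k‖ ^ 2 := sum_le_sum fun k _ => by
        refine (norm_inner_le_norm _ _).trans ?_
        have := mul_le_mul_of_nonneg_left (Matrix.l2_opNorm_mulVec X (b k)) (norm_nonneg (b k))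
        refine le_trans this (le_of_eq (by ring))
    _ = ‖X‖ := by rw [← mul_sum, h3, mul_one]

variable {n q : ℕ}

/-- Separate the basis labels of the spins inside and outside `Λ`. -/
def splitBasis (q : ℕ) (Λ : Finset (Fin n)) :
    (Fin n → Fin q) ≃ RegionBasis q Λ × ({x // x ∉ Λ} → Fin q) :=
  Equiv.piEquivPiSubtypeProd (fun x => x ∈ Λ) (fun _ => Fin q)

/-- The operator `X ⊗ Y` with `X` acting on the spins in `Λ` and `Y` on the others. -/
def regionKronecker (Λ : Finset (Fin n)) (X : RegionOp q Λ)
    (Y : Matrix ({x // x ∉ Λ} → Fin q) ({x // x ∉ Λ} → Fin q) ℂ) : Op n q :=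
  (X ⊗ₖ Y).submatrix (splitBasis q Λ) (splitBasis q Λ)

theorem regionKronecker_mul (Λ : Finset (Fin n)) (X X' : RegionOp q Λ)
    (Y Y' : Matrix ({x // x ∉ Λ} → Fin q) ({x // x ∉ Λ} → Fin q) ℂ) :
    regionKronecker Λ X Y * regionKronecker Λ X' Y' = regionKronecker Λ (X * X') (Y * Y') := by
  unfold regionKronecker
  rw [Matrix.submatrix_mul_equiv, Matrix.mul_kronecker_mul]

theorem trace_regionKronecker (Λ : Finset (Fin n)) (X : RegionOp q Λ)
    (Y : Matrix ({x // x ∉ Λ} → Fin q) ({x // x ∉ Λ} → Fin q) ℂ) :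
    (regionKronecker Λ X Y).trace = X.trace * Y.trace := by
  rw [← Matrix.trace_kronecker]
  exact Fintype.sum_equiv (splitBasis q Λ) _ _ fun i => rfl

theorem embed_eq (Λ : Finset (Fin n)) (X : RegionOp q Λ) :
    embed Λ X = regionKronecker Λ X 1 := by
  ext i j
  simp only [embed, regionKronecker, Matrix.of_apply, Matrix.submatrix_apply,
    Matrix.kronecker_apply, Matrix.one_apply, splitBasis, Equiv.piEquivPiSubtypeProd_apply,
    funext_iff, Subtype.forall, mul_ite, mul_one, mul_zero]

theorem tensorOp_eq (Λ : Finset (Fin n)) (ρ : Fin n → Matrix (Fin q) (Fin q) ℂ) :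
    tensorOp ρ = regionKronecker Λ (tensorMatrix fun x => ρ x) (tensorMatrix fun x => ρ x) := by
  ext i j
  have h := (Fintype.prod_subtype_mul_prod_subtype (fun x => x ∈ Λ)
    (fun x => ρ x (i x) (j x))).symm
  simp only [tensorOp, regionKronecker, tensorMatrix, Matrix.of_apply, Matrix.submatrix_apply,
    Matrix.kronecker_apply, splitBasis, Equiv.piEquivPiSubtypeProd_apply]
  convert h

theorem regionKronecker_one (Λ : Finset (Fin n)) :
    regionKronecker Λ (1 : RegionOp q Λ) 1 = 1 := by
  unfold regionKronecker
  rw [Matrix.one_kronecker_one, Matrix.submatrix_one_equiv]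

/-- `X ↦ X ⊗ 1` is a unital *-homomorphism. -/
def embedHom (q : ℕ) (Λ : Finset (Fin n)) : RegionOp q Λ →⋆ₐ[ℂ] Op n q where
  toFun := embed Λ
  map_one' := by rw [embed_eq, regionKronecker_one]
  map_mul' X Y := by simp only [embed_eq, regionKronecker_mul, mul_one]
  map_zero' := by ext; simp [embed]
  map_add' X Y := by
    ext i j
    simp only [embed, Matrix.of_apply, Matrix.add_apply]
    split_ifs <;> simp
  commutes' c := by
    rw [Algebra.algebraMap_eq_smul_one, Algebra.algebraMap_eq_smul_one,
      ← regionKronecker_one (q := q) Λ, embed_eq]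
    simp only [regionKronecker, Matrix.smul_kronecker]
    rfl
  map_star' X := by
    ext i j
    simp only [embed, Matrix.of_apply, Matrix.star_apply, @eq_comm _ (j _) (i _)]
    split_ifs <;> simp

/-- A *-homomorphism of C*-algebras is contractive. -/
theorem norm_embed_le (Λ : Finset (Fin n)) (X : RegionOp q Λ) : ‖embed Λ X‖ ≤ ‖X‖ :=
  NonUnitalStarAlgHom.norm_apply_le (embedHom q Λ) X

theorem embed_isHermitian {Λ : Finset (Fin n)} {X : RegionOp q Λ} (hX : X.IsHermitian) :
    (embed Λ X).IsHermitian :=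
  (map_star (embedHom q Λ) X).symm.trans (congrArg (embed Λ) hX)

theorem exists_regionKronecker_of_disjoint {Λ Λ' : Finset (Fin n)} (h : Disjoint Λ Λ')
    (Z : RegionOp q Λ') : ∃ Y, embed Λ' Z = regionKronecker Λ 1 Y := by
  have hmem : ∀ x : Λ', (x : Fin n) ∉ Λ := fun x => Finset.disjoint_right.1 h x.2
  refine ⟨Matrix.of fun i j => if ∀ x : {x // x ∉ Λ}, (x : Fin n) ∉ Λ' → i x = j x then
    Z (fun x => i ⟨x, hmem x⟩) (fun x => j ⟨x, hmem x⟩) else 0, ?_⟩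
  ext i j
  simp only [embed, regionKronecker, Matrix.of_apply, Matrix.submatrix_apply,
    Matrix.kronecker_apply, Matrix.one_apply, splitBasis, Equiv.piEquivPiSubtypeProd_apply,
    funext_iff, Subtype.forall, ite_mul, one_mul, zero_mul, ← ite_and]
  refine if_congr ⟨fun hij => ⟨fun x hx => hij x (Finset.disjoint_left.1 h hx),
    fun x _ hx => hij x hx⟩, fun hij x hx => ?_⟩ rfl rfl
  by_cases hxΛ : x ∈ Λ
  exacts [hij.1 x hxΛ, hij.2 x hxΛ hx]

/-- If one factor commutes with a submonoid containing all other factors, it can be moved to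
the front of the product. -/
theorem exists_prod_ofFn_eq_mul {A : Type*} [Monoid A] (T : Submonoid A) :
    ∀ {m : ℕ} (f : Fin m → A) (i : Fin m), (∀ j, j ≠ i → f j ∈ T) →
      (∀ y ∈ T, y * f i = f i * y) → ∃ y ∈ T, (List.ofFn f).prod = f i * y := by
  intro m
  induction m with
  | zero => exact fun f i => i.elim0
  | succ m ih =>
    intro f i hf hc
    rw [List.ofFn_succ, List.prod_cons]
    induction i using Fin.cases with
    | zero =>
      refine ⟨_, ?_, rfl⟩
      refine T.list_prod_mem fun y hy => ?_
      obtain ⟨j, rfl⟩ := (List.mem_ofFn' _ _).1 hy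
      exact hf _ (Fin.succ_ne_zero j)
    | succ i =>
      obtain ⟨y, hy, hprod⟩ := ih (fun j => f j.succ) i
        (fun j hj => hf _ fun h => hj (Fin.succ_injective _ h)) hc
      have h0 := hf 0 (Fin.succ_ne_zero i).symm
      exact ⟨f 0 * y, T.mul_mem h0 hy, by rw [hprod, ← mul_assoc, hc _ h0, mul_assoc]⟩

theorem sum_pow_eq_sum_prod_ofFn {A ι : Type*} [Semiring A] [Fintype ι] (g : ι → A) (m : ℕ) :
    (∑ l, g l) ^ m = ∑ f : Fin m → ι, (List.ofFn fun i => g (f i)).prod := by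
  induction m with
  | zero => simp
  | succ m ih =>
    rw [pow_succ', ih, sum_mul_sum, ← Fintype.sum_prod_type']
    refine Fintype.sum_equiv (Fin.consEquiv fun _ => ι) _ _ fun p => ?_
    simp [List.ofFn_succ, Fin.consEquiv]

theorem norm_prod_ofFn_le {A : Type*} [NormedRing A] (h1 : ‖(1 : A)‖ ≤ 1) {m : ℕ}
    (f : Fin m → A) : ‖(List.ofFn f).prod‖ ≤ ∏ i, ‖f i‖ := by
  induction m with
  | zero => simpa using h1
  | succ m ih =>
    rw [List.ofFn_succ, List.prod_cons, Fin.prod_univ_succ]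
    exact (norm_mul_le _ _).trans (mul_le_mul_of_nonneg_left (ih _) (norm_nonneg _))

/-- Only an inequality, since the norm is `0` for an empty index type. -/
theorem norm_one_matrix_le (ι : Type*) [Fintype ι] [DecidableEq ι] :
    ‖(1 : Matrix ι ι ℂ)‖ ≤ 1 := by
  rw [← Matrix.diagonal_one, Matrix.l2_opNorm_diagonal]
  exact (pi_norm_le_iff_of_nonneg zero_le_one).2 fun i => by simp

section State

variable {ω : Op n q}

theorem IsProductState.isState (hω : IsProductState ω) : IsState ω := by
  obtain ⟨ρ, hρ, rfl⟩ := hω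
  exact ⟨posSemidef_tensorMatrix fun x => (hρ x).1,
    (trace_tensorMatrix ρ).trans (prod_eq_one fun x _ => (hρ x).2)⟩

/-- The trace factorizes over `Λ` and its complement. The complementary factor of `ω` has trace one,
so `hX` says precisely that the factor on `Λ` vanishes. -/
theorem IsProductState.trace_mul_embed_mul_eq_zero (hω : IsProductState ω)
    {Λ : Finset (Fin n)} {X : RegionOp q Λ} (hX : (ω * embed Λ X).trace = 0)
    (Y : Matrix ({x // x ∉ Λ} → Fin q) ({x // x ∉ Λ} → Fin q) ℂ) :
    (ω * (embed Λ X * regionKronecker Λ 1 Y)).trace = 0 := by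
  obtain ⟨ρ, hρ, rfl⟩ := hω
  have hB : (tensorMatrix fun x : {x // x ∉ Λ} => ρ x).trace = 1 :=
    (trace_tensorMatrix _).trans (prod_eq_one fun x _ => (hρ x).2)
  rw [embed_eq, tensorOp_eq Λ, regionKronecker_mul, trace_regionKronecker, mul_one, hB,
    mul_one] at hX
  rw [embed_eq, tensorOp_eq Λ, regionKronecker_mul, regionKronecker_mul, trace_regionKronecker,
    mul_one, hX, zero_mul]

/-- Products of centered local observables one of which does not overlap any other have zero
expectation in product states. -/
theorem IsProductState.trace_mul_prod_eq_zero (hω : IsProductState ω)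
    {k : (Λ : Finset (Fin n)) → RegionOp q Λ}
    (hk : ∀ Λ, (ω * embed Λ (k Λ)).trace = 0) {m : ℕ} (f : Fin m → Finset (Fin n)) (i : Fin m)
    (hi : ∀ j, j ≠ i → Disjoint (f i) (f j)) :
    (ω * (List.ofFn fun j => embed (f j) (k (f j))).prod).trace = 0 := by
  -- `T` consists of the operators `1 ⊗ Y` acting off `f i`; they commute with the isolated factor,
  -- which can thus be pulled to the front.
  let T : Submonoid (Op n q) :=
    { carrier := Set.range (regionKronecker (f i) 1)
      one_mem' := ⟨1, regionKronecker_one _⟩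
      mul_mem' := by
        rintro _ _ ⟨Y, rfl⟩ ⟨Y', rfl⟩
        exact ⟨Y * Y', by rw [regionKronecker_mul, mul_one]⟩ }
  obtain ⟨y, ⟨Y, rfl⟩, hy⟩ := exists_prod_ofFn_eq_mul T
    (fun j => embed (f j) (k (f j))) i
    (fun j hj => by
      obtain ⟨Y, hY⟩ := exists_regionKronecker_of_disjoint (hi j hj) (k (f j))
      exact ⟨Y, hY.symm⟩)
    (by
      rintro _ ⟨Y, rfl⟩
      rw [embed_eq, regionKronecker_mul, regionKronecker_mul, one_mul, mul_one, one_mul, mul_one])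
  rw [hy]
  exact hω.trace_mul_embed_mul_eq_zero (hk _) Y

end State

end SpinSystem

/-! ### Existence of optimal decompositions -/

namespace SpinSystem
open Finset

variable {n q : ℕ}

theorem iSup_sum_norm_bddAbove (h : (Λ : Finset (Fin n)) → RegionOp q Λ) :
    BddAbove (Set.range fun x : Fin n => ∑ Λ : Finset (Fin n) with x ∈ Λ, ‖h Λ‖) :=
  (Set.finite_range _).bddAbove

theorem sum_norm_le_decompositionNorm (h : (Λ : Finset (Fin n)) → RegionOp q Λ) (x : Fin n) :
    2 * ∑ Λ : Finset (Fin n) with x ∈ Λ, ‖h Λ‖ ≤ decompositionNorm h :=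
  mul_le_mul_of_nonneg_left (le_ciSup (iSup_sum_norm_bddAbove h) x) zero_le_two

theorem decompositionNorm_nonneg (h : (Λ : Finset (Fin n)) → RegionOp q Λ) :
    0 ≤ decompositionNorm h :=
  mul_nonneg zero_le_two (Real.iSup_nonneg fun _ => sum_nonneg fun _ _ => norm_nonneg _)

theorem continuous_decompositionNorm :
    Continuous (decompositionNorm : ((Λ : Finset (Fin n)) → RegionOp q Λ) → ℝ) := by
  unfold decompositionNorm
  refine continuous_const.mul ?_
  -- Without spins the supremum is `0` by convention.
  rcases isEmpty_or_nonempty (Fin n) with hn | hn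
  · simp only [Real.iSup_of_isEmpty]
    exact continuous_const
  · simp only [← Finset.sup'_univ_eq_ciSup]
    refine Continuous.finset_sup'_apply _ fun x _ => ?_
    exact continuous_finsetSum _ fun Λ _ => (continuous_apply Λ).norm

theorem continuous_embed (Λ : Finset (Fin n)) :
    Continuous (embed Λ : RegionOp q Λ → Op n q) :=
  (embedHom q Λ).toAlgHom.toLinearMap.continuous_of_finiteDimensional

theorem isClosed_isDecomposition (H : Op n q) :
    IsClosed {h : (Λ : Finset (Fin n)) → RegionOp q Λ | IsDecomposition H h} := by
  have h1 : IsClosed {h : (Λ : Finset (Fin n)) → RegionOp q Λ | ∀ Λ, (h Λ).IsHermitian} := by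
    simp only [Set.ofPred_forall]
    exact isClosed_iInter fun Λ =>
      isClosed_eq (continuous_star.comp (continuous_apply Λ)) (continuous_apply Λ)
  have h2 : IsClosed {h : (Λ : Finset (Fin n)) → RegionOp q Λ | H = ∑ Λ, embed Λ (h Λ)} :=
    isClosed_eq continuous_const
      (continuous_finsetSum _ fun Λ _ => (continuous_embed Λ).comp (continuous_apply Λ))
  exact h1.inter h2

theorem exists_isDecomposition {H : Op n q} (hH : H.IsHermitian) :
    ∃ h : (Λ : Finset (Fin n)) → RegionOp q Λ, IsDecomposition H h := by
  classical
  let X : RegionOp q (univ : Finset (Fin n)) :=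
    H.submatrix (fun i x => i ⟨x, mem_univ x⟩) (fun i x => i ⟨x, mem_univ x⟩)
  refine ⟨Pi.single univ X, fun Λ => ?_, ?_⟩
  · by_cases hΛ : Λ = univ
    · subst hΛ
      rw [Pi.single_eq_same]
      exact hH.submatrix _
    · rw [Pi.single_eq_of_ne hΛ]
      exact Matrix.isHermitian_zero
  · rw [sum_eq_single univ]
    · rw [Pi.single_eq_same]
      ext i j
      simp [embed, X]
    · intro Λ _ hΛ
      rw [Pi.single_eq_of_ne hΛ]
      exact map_zero (embedHom q Λ)
    · simp

/-- Nonemptiness makes `embed ∅` injective, hence isometric; on a zero space the scalar `X` would be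
lost. -/
theorem norm_embed_empty [Nonempty (Fin n → Fin q)] (X : RegionOp q (∅ : Finset (Fin n))) :
    ‖embed ∅ X‖ = ‖X‖ := by
  refine NonUnitalStarAlgHom.norm_map (embedHom q (∅ : Finset (Fin n))) (fun X Y hXY => ?_) X
  obtain ⟨b⟩ := ‹Nonempty (Fin n → Fin q)›
  ext i j
  have h : embed ∅ X b b = embed ∅ Y b b := congrFun (congrFun hXY b) b
  simp only [embed, Matrix.of_apply, implies_true, if_true] at h
  rwa [Subsingleton.elim i (fun x => b x), Subsingleton.elim j (fun x => b x)]

/-- Coercivity for the compactness argument. `decompositionNorm` does not see the scalar term `h ∅`,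
but that term is `H` minus all the others. -/
theorem IsDecomposition.norm_le [Nonempty (Fin n → Fin q)] {H : Op n q}
    {h : (Λ : Finset (Fin n)) → RegionOp q Λ} (hh : IsDecomposition H h) :
    ‖h‖ ≤ ‖H‖ + ((univ : Finset (Finset (Fin n))).card + 1) * decompositionNorm h := by
  have hD := decompositionNorm_nonneg h
  have hne : ∀ Λ : Finset (Fin n), Λ ≠ ∅ → ‖h Λ‖ ≤ decompositionNorm h := by
    intro Λ hΛ
    obtain ⟨x, hx⟩ := nonempty_iff_ne_empty.2 hΛ
    have h1 := sum_norm_le_decompositionNorm h x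
    have h2 : ‖h Λ‖ ≤ ∑ Λ : Finset (Fin n) with x ∈ Λ, ‖h Λ‖ :=
      single_le_sum (f := fun Λ => ‖h Λ‖) (fun Λ _ => norm_nonneg _)
        (mem_filter.2 ⟨mem_univ Λ, hx⟩)
    have := norm_nonneg (h Λ)
    linarith
  have hcard : (0 : ℝ) ≤ (univ : Finset (Finset (Fin n))).card := Nat.cast_nonneg _
  refine (pi_norm_le_iff_of_nonneg (by positivity)).2 fun Λ => ?_
  by_cases hΛ : Λ = ∅
  · subst hΛ
    have hsum : embed ∅ (h ∅) = H - ∑ Λ ∈ univ.erase ∅, embed Λ (h Λ) := by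
      rw [hh.2, ← add_sum_erase _ _ (mem_univ ∅), add_sub_cancel_right]
    rw [← norm_embed_empty, hsum]
    have h3 : ‖∑ Λ ∈ univ.erase ∅, embed Λ (h Λ)‖ ≤
        (univ : Finset (Finset (Fin n))).card * decompositionNorm h :=
      calc _ ≤ ∑ Λ ∈ univ.erase ∅, decompositionNorm h :=
            norm_sum_le_of_le _ fun Λ hΛ => (norm_embed_le _ _).trans (hne Λ (ne_of_mem_erase hΛ))
        _ = (univ.erase (∅ : Finset (Fin n))).card * decompositionNorm h := by simp
        _ ≤ _ := mul_le_mul_of_nonneg_right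
            (Nat.cast_le.2 (card_le_card (erase_subset _ _))) hD
    have := norm_sub_le H (∑ Λ ∈ univ.erase ∅, embed Λ (h Λ))
    linarith
  · have := hne Λ hΛ
    have := mul_nonneg hcard hD
    have := norm_nonneg H
    linarith

/-- The minimum in the definition of the local norm is attained. -/
theorem exists_isOptimalDecomposition [Nonempty (Fin n → Fin q)] {H : Op n q}
    (hH : H.IsHermitian) :
    ∃ h : (Λ : Finset (Fin n)) → RegionOp q Λ, IsOptimalDecomposition H h := by
  obtain ⟨h₀, hh₀⟩ := exists_isDecomposition hH
  have : ProperSpace ((Λ : Finset (Fin n)) → RegionOp q Λ) := FiniteDimensional.proper ℂ _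
  -- Minimizing over this compact sublevel set is enough: decompositions outside it are worse than
  -- `h₀`.
  set K : Set ((Λ : Finset (Fin n)) → RegionOp q Λ) :=
    {h | IsDecomposition H h} ∩ {h | decompositionNorm h ≤ decompositionNorm h₀}
  have hK : IsCompact K := by
    refine Metric.isCompact_of_isClosed_isBounded ((isClosed_isDecomposition H).inter
      (isClosed_le continuous_decompositionNorm continuous_const)) ?_
    refine isBounded_iff_forall_norm_le.2 ⟨_, fun h hh => hh.1.norm_le.trans
      (add_le_add_right (mul_le_mul_of_nonneg_left hh.2 (by positivity)) _)⟩
  obtain ⟨h, hhK, hmin⟩ :=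
    hK.exists_isMinOn (show K.Nonempty from ⟨h₀, hh₀, le_refl (decompositionNorm h₀)⟩)
      continuous_decompositionNorm.continuousOn
  refine ⟨h, hhK.1, Eq.symm (IsLeast.csInf_eq (And.intro ⟨h, hhK.1, rfl⟩ ?_))⟩
  rintro _ ⟨h', hh', rfl⟩
  rcases le_total (decompositionNorm h') (decompositionNorm h₀) with hle | hle
  · exact hmin (show h' ∈ K from ⟨hh', hle⟩)
  · exact le_trans hhK.2 hle

/-! ### Moments and exponential moments -/

section Expectation

variable {ω : Op n q}

theorem IsState.abs_expect_le (hω : IsState ω) (X : Op n q) : |expect ω X| ≤ ‖X‖ :=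
  (Complex.abs_re_le_norm _).trans (hω.norm_trace_mul_le X)

theorem expect_smul (ω : Op n q) (c : ℝ) (X : Op n q) :
    expect ω ((c : ℂ) • X) = c * expect ω X := by
  simp [expect]

theorem expect_sum {ι : Type*} (ω : Op n q) (s : Finset ι) (X : ι → Op n q) :
    expect ω (∑ i ∈ s, X i) = ∑ i ∈ s, expect ω (X i) := by
  simp [expect, mul_sum, Matrix.trace_sum]

theorem continuous_expect (ω : Op n q) : Continuous (expect ω) := by
  unfold expect
  fun_prop

theorem ofReal_expect (hω : ω.IsHermitian) {X : Op n q} (hX : X.IsHermitian) :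
    ((expect ω X : ℝ) : ℂ) = (ω * X).trace :=
  Complex.ext rfl (trace_mul_im hω hX).symm

theorem embed_centered (Λ : Finset (Fin n)) (X : RegionOp q Λ) :
    embed Λ (centered ω Λ X) = embed Λ X - ((expect ω (embed Λ X) : ℝ) : ℂ) • 1 := by
  have h := map_sub (embedHom q Λ) X (((expect ω (embed Λ X) : ℝ) : ℂ) • 1)
  rw [map_smul, map_one] at h
  exact h

theorem trace_mul_embed_centered (hω : IsState ω) {Λ : Finset (Fin n)} {X : RegionOp q Λ}
    (hX : X.IsHermitian) : (ω * embed Λ (centered ω Λ X)).trace = 0 := by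
  rw [embed_centered, mul_sub, Matrix.trace_sub,
    ← ofReal_expect hω.1.isHermitian (embed_isHermitian hX)]
  simp [hω.2]

/-- This factor `2` is absorbed by the one in the local norm. -/
theorem norm_centered_le (hω : IsState ω) (Λ : Finset (Fin n)) (X : RegionOp q Λ) :
    ‖centered ω Λ X‖ ≤ 2 * ‖X‖ := by
  unfold centered
  refine (norm_sub_le _ _).trans ?_
  rw [norm_smul, Complex.norm_real, Real.norm_eq_abs]
  have h1 := (hω.abs_expect_le (embed Λ X)).trans (norm_embed_le Λ X)
  have h2 := mul_le_mul h1 (norm_one_matrix_le (RegionBasis q Λ)) (norm_nonneg _) (norm_nonneg X)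
  linarith

/-- Only clusters in which every observable overlaps another one contribute to the moments. -/
theorem IsProductState.expect_pow_le (hω : IsProductState ω)
    {k : (Λ : Finset (Fin n)) → RegionOp q Λ}
    (hk : ∀ Λ, (ω * embed Λ (k Λ)).trace = 0) (m : ℕ) :
    expect ω ((∑ Λ, embed Λ (k Λ)) ^ m) ≤
      clusterWeight (fun Λ Λ' : Finset (Fin n) => ¬ Disjoint Λ Λ') (fun Λ => ‖k Λ‖) m := by
  classical
  rw [sum_pow_eq_sum_prod_ofFn, expect_sum]
  refine sum_le_sum fun f _ => ?_
  split_ifs with hf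
  · refine (le_abs_self _).trans ((hω.isState.abs_expect_le _).trans ?_)
    refine (norm_prod_ofFn_le (norm_one_matrix_le _) _).trans ?_
    exact prod_le_prod (fun _ _ => norm_nonneg _) fun i _ => norm_embed_le _ _
  · simp only [NoIsolated, not_forall, not_exists, not_and, not_not] at hf
    obtain ⟨i, hi⟩ := hf
    rw [expect, hω.trace_mul_prod_eq_zero hk f i hi, Complex.zero_re]

/-- A region overlapping `Λ` contains a spin of `Λ`: union bound over these spins. -/
theorem sum_overlap_le {b : Finset (Fin n) → ℝ} (hb : ∀ Λ, 0 ≤ b Λ) {J : ℝ}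
    (hbJ : ∀ x, ∑ Λ : Finset (Fin n) with x ∈ Λ, b Λ ≤ J) (Λ : Finset (Fin n))
    [DecidablePred fun Λ' => ¬ Disjoint Λ Λ'] :
    ∑ Λ' with ¬ Disjoint Λ Λ', b Λ' ≤ Λ.card * J := by
  refine le_trans ?_ ((sum_le_sum fun x _ => hbJ x).trans_eq (by rw [sum_const, nsmul_eq_mul]))
  simp only [sum_filter]
  rw [sum_comm]
  refine sum_le_sum fun Λ' _ => ?_
  split_ifs with hΛ'
  · refine sum_nonneg fun y _ => ?_
    split_ifs <;> simp [hb]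
  · obtain ⟨x, hx, hx'⟩ := Finset.not_disjoint_iff.1 hΛ'
    refine le_trans (by rw [if_pos hx']) (single_le_sum (f := fun x => if x ∈ Λ' then b Λ' else 0)
      (fun y _ => ?_) hx)
    split_ifs <;> simp [hb]

theorem IsProductState.expect_exp_le (hω : IsProductState ω)
    {k : (Λ : Finset (Fin n)) → RegionOp q Λ}
    (hk : ∀ Λ, (ω * embed Λ (k Λ)).trace = 0) {J : ℝ} (hJ : 0 ≤ J)
    (hkJ : ∀ x, ∑ Λ : Finset (Fin n) with x ∈ Λ, ‖k Λ‖ ≤ J) :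
    expect ω (NormedSpace.exp (∑ Λ, embed Λ (k Λ))) ≤
      Real.exp (∑ Λ : Finset (Fin n),
        (Real.exp (Λ.card * J) - 1 - Λ.card * J / 2) * ‖k Λ‖) := by
  have hcluster := sum_clusterWeight_div_factorial_le
    (r := fun Λ Λ' : Finset (Fin n) => ¬ Disjoint Λ Λ') (a := fun Λ => ‖k Λ‖)
    (x := fun Λ => Λ.card * J) (fun Λ Λ' h h' => h h'.symm) (fun _ => norm_nonneg _)
    (fun Λ => mul_nonneg (Nat.cast_nonneg _) hJ)
    (fun Λ _ => sum_overlap_le (fun _ => norm_nonneg _) hkJ Λ)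
  have hmom := hω.expect_pow_le hk
  generalize (∑ Λ, embed Λ (k Λ)) = K at hmom ⊢
  have hsum := (NormedSpace.exp_series_hasSum_exp' (𝕂 := ℂ) K).tendsto_sum_nat
  have hlim := ((continuous_expect ω).tendsto _).comp hsum
  refine le_of_tendsto' hlim fun M => le_trans ?_ (hcluster M)
  rw [Function.comp_apply, expect_sum]
  refine sum_le_sum fun m _ => ?_
  have h := expect_smul ω ((m.factorial : ℝ)⁻¹) (K ^ m)
  rw [Complex.ofReal_inv, Complex.ofReal_natCast] at h
  rw [h, inv_mul_eq_div]
  exact div_le_div_of_nonneg_right (hmom m) (Nat.cast_nonneg _)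

end Expectation

end SpinSystem

/-! ### The exponential bound -/

theorem mainTheorem3 (n q : ℕ) (ω : SpinSystem.Op n q) (hω : SpinSystem.IsProductState ω)
    (H : SpinSystem.Op n q) (hH : H.IsHermitian) :
    (∃ h : (Λ : Finset (Fin n)) → SpinSystem.RegionOp q Λ,
      SpinSystem.IsOptimalDecomposition H h) ∧
    ∀ h : (Λ : Finset (Fin n)) → SpinSystem.RegionOp q Λ,
      SpinSystem.IsOptimalDecomposition H h →
      SpinSystem.expect ω (NormedSpace.exp H) ≤
        Real.exp (SpinSystem.expect ω H +
          ∑ Λ : Finset (Fin n),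
            (Real.exp ((Λ.card : ℝ) * SpinSystem.locNorm H) - 1
                - (Λ.card : ℝ) * SpinSystem.locNorm H / 2)
              * ‖SpinSystem.centered ω Λ (h Λ)‖) := by
  open SpinSystem in
  have hst := hω.isState
  -- A state has trace one, so the Hilbert space is nonzero; this excludes `q = 0` with `n ≥ 1`.
  have hne : Nonempty (Fin n → Fin q) := by
    by_contra hempty
    rw [not_nonempty_iff] at hempty
    have h := hst.2
    rw [Matrix.trace, Finset.univ_eq_empty, Finset.sum_empty] at h
    exact zero_ne_one h
  refine ⟨exists_isOptimalDecomposition hH, fun h hh => ?_⟩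
  obtain ⟨hdec, hnorm⟩ := hh
  rw [← hnorm]
  have hcent : H = ((expect ω H : ℝ) : ℂ) • (1 : Op n q) +
      ∑ Λ, embed Λ (centered ω Λ (h Λ)) := by
    simp only [embed_centered, Finset.sum_sub_distrib]
    rw [← Finset.sum_smul, ← Complex.ofReal_sum, ← expect_sum, ← hdec.2, add_sub_cancel]
  have hexp : NormedSpace.exp H = ((Real.exp (expect ω H) : ℝ) : ℂ) •
      NormedSpace.exp (∑ Λ, embed Λ (centered ω Λ (h Λ))) := by
    have hcomm : Commute (((expect ω H : ℝ) : ℂ) • (1 : Op n q))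
        (∑ Λ, embed Λ (centered ω Λ (h Λ))) := (Commute.one_left _).smul_left _
    have h1 : NormedSpace.exp (((expect ω H : ℝ) : ℂ) • (1 : Op n q)) =
        ((Real.exp (expect ω H) : ℝ) : ℂ) • 1 := by
      rw [← Algebra.algebraMap_eq_smul_one, ← Algebra.algebraMap_eq_smul_one,
        Complex.ofReal_exp, Complex.exp_eq_exp_ℂ]
      exact (NormedSpace.algebraMap_exp_comm _).symm
    conv_lhs => rw [hcent]
    rw [Matrix.exp_add_of_commute _ _ hcomm, h1, smul_mul_assoc, one_mul]
  rw [hexp, expect_smul, Real.exp_add]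
  refine mul_le_mul_of_nonneg_left ?_ (Real.exp_pos _).le
  -- Here `J` is the local norm: centering at most doubles the norms, and `decompositionNorm`
  -- contains the factor `2`.
  refine hω.expect_exp_le (fun Λ => trace_mul_embed_centered hst (hdec.1 Λ))
    (decompositionNorm_nonneg h) fun x => le_trans ?_ (sum_norm_le_decompositionNorm h x)
  rw [Finset.mul_sum]
  exact Finset.sum_le_sum fun Λ _ => norm_centered_le hst Λ _
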